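/- Let $A=\{v_1,v_2\}$, $B=\{v_3,v_4\}$, $C=\{v_5,v_6\}$, $D=\{v_7,v_8\}$. The Vamos matroid is the matroid on $\{v_1,\dots,v_8\}$ whose independent sets are all sets of size less than $5$ except $A\cup B$, $A\cup C$, $B\cup C$, $B\cup D$ and $C\cup D$. Let $d\in A$ (the dealer), and let $\Gamma$ be the access structure on the eight participants $v_1,\dots,v_8$ induced by the Vamos matroid with dealer $d$: a set $T\subseteq\{v_1,\dots,v_8\}$ is qualified ($T\in\Gamma$) if $d\in T$, or if $T$ contains a set $Y$ with $d\notin Y$ such that $Y\cup\{d\}$ is a circuit. (For $d=v_1$ this is the access structure $V_1$.) Let $S$ (the secret) and $X_1,\dots,X_8$ (the shares of $v_1,\dots,v_8$) be finite-valued random variables on a common probability space. For a set $T$ of participants let $H(T)$ be the joint Shannon entropy of the shares of the members of $T$, and let $H(S\mid T)=H(T\cup\{S\})-H(T)$, where $H(T\cup\{S\})$ is the joint entropy of the secret and these shares. Suppose that $H(S)>0$ and that these random variables form a perfect secret sharing scheme for $\Gamma$, that is, $H(S\mid T)=0$ for every $T\in\Gamma$ and $H(S\mid T)=H(S)$ for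 every $T\notin\Gamma$. Put $h(v_i)=H(\{v_i\})/H(S)$ and $$\lambda=\Bigl(\max_{1\le i\le 8}h(v_i)\Bigr)-1.$$ Then $\lambda\ge \frac{2}{19}$. -/

import Mathlib

open MeasureTheory

/-! ### Shannon entropy of finite-valued random variables -/

section Entropy

variable {Ω : Type*} [MeasurableSpace Ω]

/-- Shannon entropy (natural logarithm) of a random variable `Y` with values in a finite type:
`H(Y) = -∑ y, P(Y = y) log P(Y = y)`. -/
noncomputable def entropy (μ : Measure Ω) {β : Type*} [Fintype β] (Y : Ω → β) : ℝ :=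
  ∑ y, Real.negMulLog (μ.real (Y ⁻¹' {y}))

/-- Conditional entropy `H(Y | Z) = H(Y, Z) - H(Z)`. -/
noncomputable def condEntropy (μ : Measure Ω) {β γ : Type*} [Fintype β] [Fintype γ]
    (Y : Ω → β) (Z : Ω → γ) : ℝ :=
  entropy μ (fun ω => (Y ω, Z ω)) - entropy μ Z

/-- The joint random variable of all the shares `X i` with `i ∈ T`. -/
def jointShare {P : Type*} {α : P → Type*} (X : ∀ i, Ω → α i) (T : Finset P) :
    Ω → (∀ i : T, α i) :=
  fun ω i => X i ω

/-! ### Perfect secret sharing schemes -/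

/-- The secret `S` and the shares `X i`, `i ∈ P`, form a perfect secret sharing scheme for the
access structure `Γ` (the collection of qualified sets of participants): a qualified set determines
the secret, an unqualified set has no information on it. -/
structure IsPerfectScheme {P : Type*} [DecidableEq P] (Γ : Set (Finset P)) (μ : Measure Ω)
    {σ : Type*} [Fintype σ] {α : P → Type*} [∀ i, Fintype (α i)]
    (S : Ω → σ) (X : ∀ i, Ω → α i) : Prop where
  qualified : ∀ T : Finset P, T ∈ Γ → condEntropy μ S (jointShare X T) = 0
  unqualified : ∀ T : Finset P, T ∉ Γ → condEntropy μ S (jointShare X T) = entropy μ S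

/-- Normalized entropy `h(T) = H(T) / H(S)` of a set `T` of participants. -/
noncomputable def normEntropy {P : Type*} [DecidableEq P] (μ : Measure Ω)
    {σ : Type*} [Fintype σ] {α : P → Type*} [∀ i, Fintype (α i)]
    (S : Ω → σ) (X : ∀ i, Ω → α i) (T : Finset P) : ℝ :=
  entropy μ (jointShare X T) / entropy μ S

/-- `λ = (max_i h(v_i)) - 1` for a scheme on the eight participants `Fin 8`. -/
noncomputable def lambdaExcess (μ : Measure Ω)
    {σ : Type*} [Fintype σ] {α : Fin 8 → Type*} [∀ i, Fintype (α i)]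
    (S : Ω → σ) (X : ∀ i, Ω → α i) : ℝ :=
  Finset.univ.sup' Finset.univ_nonempty (fun i : Fin 8 => normEntropy μ S X {i}) - 1

end Entropy

/-! ### Access structures induced by a matroid -/

/-- The access structure induced by the matroid `M` with dealer `d`, where the dealer is counted as
a participant who is qualified individually. The other minimal qualified sets are the `Y` not
containing `d` for which `Y ∪ {d}` is a circuit; a set is qualified if it contains a minimal
qualified set. -/
def inducedAccess {Q : Type*} [DecidableEq Q] (M : Matroid Q) (d : Q) : Set (Finset Q) :=
  {T | d ∈ T ∨ ∃ Y ⊆ T, d ∉ Y ∧ M.IsCircuit (insert d Y : Finset Q)}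

/-! ### The Vamos matroid; the element `v_i` is `i - 1 : Fin 8` -/

namespace Vamos

/-- The Vamos pair `A = {v_1, v_2}`. -/
def A : Finset (Fin 8) := {0, 1}
/-- The Vamos pair `B = {v_3, v_4}`. -/
def B : Finset (Fin 8) := {2, 3}
/-- The Vamos pair `C = {v_5, v_6}`. -/
def C : Finset (Fin 8) := {4, 5}
/-- The Vamos pair `D = {v_7, v_8}`. -/
def D : Finset (Fin 8) := {6, 7}

/-- The five dependent sets of size four. -/
def fourCircuits : Finset (Finset (Fin 8)) := {A ∪ B, A ∪ C, B ∪ C, B ∪ D, C ∪ D}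

/-- The independent sets: all sets of size less than five except the five sets above. -/
def Indep (I : Finset (Fin 8)) : Prop := I.card < 5 ∧ I ∉ fourCircuits

set_option maxRecDepth 10000 in
theorem card_of_mem {I : Finset (Fin 8)} (h' : I ∈ fourCircuits) : I.card = 4 := by
  have h : ∀ I ∈ fourCircuits, I.card = 4 := by decide
  exact h I h'

set_option maxRecDepth 10000 in
theorem card_inter_le {I J : Finset (Fin 8)} (hI : I ∈ fourCircuits) (hJ : J ∈ fourCircuits)
    (hne : I ≠ J) : (I ∩ J).card ≤ 2 := by
  have h : ∀ I ∈ fourCircuits, ∀ J ∈ fourCircuits, I ≠ J → (I ∩ J).card ≤ 2 := by decide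
  exact h I hI J hJ hne

theorem indep_of_card_lt {I : Finset (Fin 8)} (h : I.card < 4) : Indep I :=
  ⟨by omega, fun hm => by have := card_of_mem hm; omega⟩

theorem indep_subset {I J : Finset (Fin 8)} (hJ : Indep J) (h : I ⊆ J) : Indep I := by
  rcases h.eq_or_ssubset with rfl | hlt
  · exact hJ
  · have h1 := Finset.card_lt_card hlt
    have h2 := hJ.1
    exact indep_of_card_lt (by omega)

theorem indep_aug {I J : Finset (Fin 8)} (hJ : Indep J)
    (hlt : I.card < J.card) : ∃ e ∈ J, e ∉ I ∧ Indep (insert e I) := by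
  by_cases h3 : I.card < 3
  · obtain ⟨e, heJ, heI⟩ := Finset.exists_mem_notMem_of_card_lt_card hlt
    refine ⟨e, heJ, heI, indep_of_card_lt ?_⟩
    rw [Finset.card_insert_of_notMem heI]; omega
  have hJ5 := hJ.1
  by_contra! hcon
  have hmem : ∀ e ∈ J, e ∉ I → insert e I ∈ fourCircuits := by
    intro e heJ heI
    by_contra hn
    exact hcon e heJ heI ⟨by rw [Finset.card_insert_of_notMem heI]; omega, hn⟩
  obtain ⟨e, heJ, heI⟩ := Finset.exists_mem_notMem_of_card_lt_card hlt
  have he := hmem e heJ heI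
  have huniq : ∀ f ∈ J, f ∉ I → f = e := by
    intro f hfJ hfI
    by_contra hfe
    have hne : insert f I ≠ insert e I := by
      intro heq
      have : f ∈ insert e I := heq ▸ Finset.mem_insert_self f I
      rcases Finset.mem_insert.1 this with h | h
      · exact hfe h
      · exact hfI h
    have h2 := card_inter_le (hmem f hfJ hfI) he hne
    have hI : I ⊆ insert f I ∩ insert e I :=
      Finset.subset_inter (Finset.subset_insert _ _) (Finset.subset_insert _ _)
    have := Finset.card_le_card hI
    omega
  have hsub : J ⊆ insert e I := by
    intro f hfJ
    by_cases hfI : f ∈ I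
    · exact Finset.mem_insert_of_mem hfI
    · rw [huniq f hfJ hfI]; exact Finset.mem_insert_self e I
  have hJe : J = insert e I := by
    refine Finset.eq_of_subset_of_card_le hsub ?_
    rw [Finset.card_insert_of_notMem heI]; omega
  exact hJ.2 (hJe ▸ he)

/-- The Vamos matroid on `{v_1, …, v_8}`. -/
def matroid : Matroid (Fin 8) :=
  (IndepMatroid.ofFinset Set.univ Indep (indep_of_card_lt (by simp))
    (fun _ _ hJ h => indep_subset hJ h) (fun _ _ _ hJ h => indep_aug hJ h)
    (fun _ _ => Set.subset_univ _)).matroid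

theorem matroid_indep_iff (I : Finset (Fin 8)) : matroid.Indep (I : Set (Fin 8)) ↔ Indep I := by
  simp [matroid]

end Vamos

/-!
The entropy of a perfect scheme for the Vamos access structure would, if all shares had the size of
the secret, be the rank function of the Vamos matroid. That function violates the Zhang–Yeung
inequality
`2 I(B ; C) ≤ I(P ; Q) + I(P ; B, C) + 3 I(B ; C | P) + I(B ; C | Q)`
for `P = A`, `Q = D` by one unit, so some share must be larger. To make this quantitative, let `e`
be the element of `A` other than the dealer and take `P = (S, X_e)`, `Q = X_D`. Perfectness
expresses each entropy with the secret in terms of the shares. Further, the entropy of the shares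
jumps by `H(S)` from an unqualified to a larger qualified set, and it is submodular with surplus
`H(S)` where two qualified sets have an unqualified intersection. These inequalities, together with
plain submodularity and the Zhang–Yeung inequality, give `H(S) ≤ 8 (m - H(S))` for the largest share
entropy `m` (`Vamos.nine_mul_secret_le`), that is `λ ≥ 1/8`, which is more than `2/19`.

The Zhang–Yeung inequality (`zhang_yeung`) is not a consequence of submodularity on the given
variables. It follows from submodularity once a copy `W` of `P`, with the same joint law with
`(B, C)` and independent of `(P, Q)` given `(B, C)`, is adjoined (`weightEntropy_copy_pair`). The
copy needs a larger outcome space, so entropy is treated for functions on a finite set `O` with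
weights (`weightEntropy`); the copy lives on `O × O`. Entropy depends on a function only through its
kernel, and submodularity (`weightEntropy_submod`) is stated for kernels, which makes regroupings of
tuples of variables a matter of propositional logic.
-/

/-! ### Entropy of functions on a finite weighted set -/

open Classical in
/-- The total weight of the fiber of `f` through the point `x`. -/
noncomputable def fiberMass {O β : Type*} [Fintype O] (p : O → ℝ) (f : O → β) (x : O) : ℝ :=
  ∑ y, if f y = f x then p y else 0

/-- Entropy of a function `f` on the finite set `O` of outcomes with weights `p`, written as the
expectation of `-log` of the mass of the fiber. It depends on `f` only through its kernel, so the
codomain need not be finite; outcomes of weight `0` contribute `0`. -/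
noncomputable def weightEntropy {O β : Type*} [Fintype O] (p : O → ℝ) (f : O → β) : ℝ :=
  -∑ x, p x * Real.log (fiberMass p f x)

section Weight

variable {O : Type*} [Fintype O] {p : O → ℝ}

theorem fiberMass_nonneg {β : Type*} (hp : ∀ x, 0 ≤ p x) (f : O → β) (x : O) :
    0 ≤ fiberMass p f x :=
  Finset.sum_nonneg fun y _ => by split_ifs <;> simp [hp]

theorem le_fiberMass {β : Type*} (hp : ∀ x, 0 ≤ p x) (f : O → β) (x : O) :
    p x ≤ fiberMass p f x := by
  classical
  have h := Finset.single_le_sum (f := fun y => if f y = f x then p y else 0)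
    (fun y _ => by split_ifs <;> simp [hp]) (Finset.mem_univ x)
  simpa [fiberMass] using h

theorem fiberMass_pos {β : Type*} (hp : ∀ x, 0 ≤ p x) (f : O → β) {x : O} (hx : p x ≠ 0) :
    0 < fiberMass p f x :=
  ((hp x).lt_of_ne' hx).trans_le (le_fiberMass hp f x)

theorem fiberMass_congr {β : Type*} (f : O → β) {x y : O} (h : f x = f y) :
    fiberMass p f x = fiberMass p f y := by
  classical
  exact Finset.sum_congr rfl fun w _ => if_congr (by rw [h]) rfl rfl

/-- Entropy only sees the kernel of a function on the support of `p`. -/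
theorem weightEntropy_congr {β γ : Type*} {f : O → β} {g : O → γ}
    (h : ∀ x y, p x ≠ 0 → p y ≠ 0 → (f x = f y ↔ g x = g y)) :
    weightEntropy p f = weightEntropy p g := by
  classical
  unfold weightEntropy
  congr 1
  refine Finset.sum_congr rfl fun x _ => ?_
  by_cases hx : p x = 0
  · simp [hx]
  · congr 2
    refine Finset.sum_congr rfl fun y _ => ?_
    by_cases hy : p y = 0
    · simp [hy]
    · exact if_congr (h y x hy hx) rfl rfl

theorem weightEntropy_mono {β γ : Type*} (hp : ∀ x, 0 ≤ p x) {f : O → β} {g : O → γ}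
    (h : ∀ x y, f x = f y → g x = g y) : weightEntropy p g ≤ weightEntropy p f := by
  classical
  unfold weightEntropy
  refine neg_le_neg (Finset.sum_le_sum fun x _ => ?_)
  by_cases hx : p x = 0
  · simp [hx]
  · refine mul_le_mul_of_nonneg_left (Real.log_le_log (fiberMass_pos hp f hx) ?_) (hp x)
    refine Finset.sum_le_sum fun y _ => ?_
    by_cases hy : f y = f x
    · rw [if_pos hy, if_pos (h _ _ hy)]
    · rw [if_neg hy]
      split_ifs <;> simp [hp]

open Classical in
/-- The kernel of `k` is the intersection of those of `f` and `g`, and that of `m` contains both.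
With `f = (X, Z)`, `g = (Y, Z)`, `k = (X, Y, Z)`, `m = Z` this says that
`∑ P(x, z) P(y, z) / P(z) ≤ 1`, the sum over the support of `(X, Y, Z)`. -/
theorem sum_div_fiberMass_le {β γ δ ε : Type*} (hp : ∀ x, 0 ≤ p x) {f : O → β} {g : O → γ}
    {k : O → δ} {m : O → ε} (hk : ∀ x y, k x = k y ↔ f x = f y ∧ g x = g y)
    (hf : ∀ x y, f x = f y → m x = m y) (hg : ∀ x y, g x = g y → m x = m y) :
    ∑ x, p x * (fiberMass p f x * fiberMass p g x / (fiberMass p k x * fiberMass p m x)) ≤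
      ∑ x, p x := by
  have hinner : ∀ y z, ∑ x, p x * ((if f y = f x then p y else 0) *
      (if g z = g x then p z else 0) / (fiberMass p k x * fiberMass p m x)) ≤
      p y * ((if m z = m y then p z else 0) / fiberMass p m y) := by
    intro y z
    have hR : 0 ≤ p y * ((if m z = m y then p z else 0) / fiberMass p m y) := by
      refine mul_nonneg (hp y) (div_nonneg ?_ (fiberMass_nonneg hp m y))
      split_ifs <;> simp [hp]
    -- the outcomes `x` that contribute form a single fiber of `k`
    by_cases hw : ∃ w, f y = f w ∧ g z = g w
    · obtain ⟨w, hw1, hw2⟩ := hw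
      have hmw : m w = m y := (hf _ _ hw1).symm
      have hmz : m z = m y := (hg _ _ hw2).trans hmw
      have hterm : ∀ x, p x * ((if f y = f x then p y else 0) *
          (if g z = g x then p z else 0) / (fiberMass p k x * fiberMass p m x)) =
          (if k x = k w then p x else 0) *
            (p y * p z / (fiberMass p k w * fiberMass p m y)) := by
        intro x
        by_cases hx : k x = k w
        · obtain ⟨h1, h2⟩ := (hk _ _).1 hx
          have h3 : f y = f x := hw1.trans h1.symm
          have h4 : g z = g x := hw2.trans h2.symm
          rw [if_pos h3, if_pos h4, if_pos hx, fiberMass_congr k hx,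
            fiberMass_congr m ((hf _ _ h1).trans hmw)]
        · rw [if_neg hx]
          by_cases h3 : f y = f x
          · have h4 : g z ≠ g x := fun h4 =>
              hx ((hk _ _).2 ⟨h3.symm.trans hw1, h4.symm.trans hw2⟩)
            simp [h4]
          · simp [h3]
      rw [Finset.sum_congr rfl fun x _ => hterm x, ← Finset.sum_mul, if_pos hmz]
      change fiberMass p k w * _ ≤ _
      by_cases hk0 : fiberMass p k w = 0
      · rw [hk0, zero_mul]
        rw [if_pos hmz] at hR
        exact hR
      · refine le_of_eq ?_
        rw [mul_comm (fiberMass p k w) (fiberMass p m y), ← div_div]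
        field_simp
    · refine le_trans (le_of_eq ?_) hR
      refine Finset.sum_eq_zero fun x _ => ?_
      by_cases h3 : f y = f x
      · have h4 : g z ≠ g x := fun h4 => hw ⟨x, h3, h4⟩
        simp [h4]
      · simp [h3]
  calc ∑ x, p x * (fiberMass p f x * fiberMass p g x / (fiberMass p k x * fiberMass p m x))
      = ∑ x, ∑ y, ∑ z, p x * ((if f y = f x then p y else 0) *
          (if g z = g x then p z else 0) / (fiberMass p k x * fiberMass p m x)) := by
        refine Finset.sum_congr rfl fun x _ => ?_
        simp only [← Finset.mul_sum, ← Finset.sum_div, ← Finset.sum_mul]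
        rfl
    _ = ∑ y, ∑ z, ∑ x, p x * ((if f y = f x then p y else 0) *
          (if g z = g x then p z else 0) / (fiberMass p k x * fiberMass p m x)) := by
        rw [Finset.sum_comm]
        exact Finset.sum_congr rfl fun y _ => Finset.sum_comm
    _ ≤ ∑ y, ∑ z, p y * ((if m z = m y then p z else 0) / fiberMass p m y) :=
        Finset.sum_le_sum fun y _ => Finset.sum_le_sum fun z _ => hinner y z
    _ ≤ ∑ y, p y := by
        refine Finset.sum_le_sum fun y _ => ?_
        rw [← Finset.mul_sum, ← Finset.sum_div]
        exact mul_le_of_le_one_right (hp y) (div_self_le_one (fiberMass p m y))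

/-- Submodularity of entropy, in terms of kernels: that of `k` is the intersection of those of `f`
and `g`, and that of `m` contains both. It follows from `log t ≤ t - 1`. -/
theorem weightEntropy_submod {β γ δ ε : Type*} (hp : ∀ x, 0 ≤ p x) {f : O → β} {g : O → γ}
    {k : O → δ} {m : O → ε} (hk : ∀ x y, k x = k y ↔ f x = f y ∧ g x = g y)
    (hf : ∀ x y, f x = f y → m x = m y) (hg : ∀ x y, g x = g y → m x = m y) :
    weightEntropy p k + weightEntropy p m ≤ weightEntropy p f + weightEntropy p g := by
  have h := sum_div_fiberMass_le hp hk hf hg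
  have key : ∑ x, p x * (Real.log (fiberMass p f x) + Real.log (fiberMass p g x) -
      Real.log (fiberMass p k x) - Real.log (fiberMass p m x)) ≤
      ∑ x, (p x * (fiberMass p f x * fiberMass p g x / (fiberMass p k x * fiberMass p m x)) -
        p x) := by
    refine Finset.sum_le_sum fun x _ => ?_
    by_cases hx : p x = 0
    · simp [hx]
    · have h1 := fiberMass_pos hp f hx
      have h2 := fiberMass_pos hp g hx
      have h3 := fiberMass_pos hp k hx
      have h4 := fiberMass_pos hp m hx
      have h5 := Real.log_le_sub_one_of_pos (div_pos (mul_pos h1 h2) (mul_pos h3 h4))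
      rw [Real.log_div (mul_pos h1 h2).ne' (mul_pos h3 h4).ne', Real.log_mul h1.ne' h2.ne',
        Real.log_mul h3.ne' h4.ne'] at h5
      have h6 := mul_le_mul_of_nonneg_left h5 (hp x)
      linarith
  rw [Finset.sum_sub_distrib] at key
  simp only [mul_sub, mul_add, Finset.sum_sub_distrib, Finset.sum_add_distrib] at key
  unfold weightEntropy
  linarith

end Weight

/-! ### Conditionally independent copies -/

section Copy

variable {O : Type*} [Fintype O] {p : O → ℝ}

open Classical in
/-- The weight on `O × O` under which the two coordinates both have law `p`, agree in `z`, and are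
conditionally independent given `z`. -/
noncomputable def copyWeight {ζ : Type*} (p : O → ℝ) (z : O → ζ) (x : O × O) : ℝ :=
  if z x.1 = z x.2 then p x.1 * p x.2 / fiberMass p z x.1 else 0

theorem copyWeight_nonneg {ζ : Type*} (hp : ∀ x, 0 ≤ p x) (z : O → ζ) (x : O × O) :
    0 ≤ copyWeight p z x := by
  unfold copyWeight
  split_ifs
  · exact div_nonneg (mul_nonneg (hp _) (hp _)) (fiberMass_nonneg hp _ _)
  · exact le_rfl

theorem copyWeight_ne_zero {ζ : Type*} {z : O → ζ} {x : O × O} (h : copyWeight p z x ≠ 0) :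
    z x.1 = z x.2 ∧ p x.1 ≠ 0 ∧ p x.2 ≠ 0 := by
  unfold copyWeight at h
  split_ifs at h with hz
  · refine ⟨hz, ?_, ?_⟩ <;> · intro h0; simp [h0] at h
  · exact absurd rfl h

theorem copyWeight_swap {ζ : Type*} (z : O → ζ) (x : O × O) :
    copyWeight p z x.swap = copyWeight p z x := by
  unfold copyWeight
  by_cases h : z x.1 = z x.2
  · simp [h, mul_comm, fiberMass_congr z h]
  · simp [h, Ne.symm h]

theorem sum_copyWeight_right {ζ : Type*} (hp : ∀ x, 0 ≤ p x) (z : O → ζ) (x : O) :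
    ∑ y, copyWeight p z (x, y) = p x := by
  classical
  have h : ∀ y, copyWeight p z (x, y) = p x / fiberMass p z x * if z y = z x then p y else 0 := by
    intro y
    simp only [copyWeight, eq_comm (a := z x)]
    split_ifs <;> ring
  rw [Finset.sum_congr rfl fun y _ => h y, ← Finset.mul_sum]
  change p x / fiberMass p z x * fiberMass p z x = p x
  by_cases hx : p x = 0
  · simp [hx]
  · exact div_mul_cancel₀ _ (fiberMass_pos hp z hx).ne'

theorem sum_copyWeight_mul_fst {ζ : Type*} (hp : ∀ x, 0 ≤ p x) (z : O → ζ) (F : O → ℝ) :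
    ∑ x, copyWeight p z x * F x.1 = ∑ x, p x * F x := by
  rw [Fintype.sum_prod_type]
  refine Finset.sum_congr rfl fun x _ => ?_
  change ∑ y, copyWeight p z (x, y) * F x = p x * F x
  rw [← Finset.sum_mul, sum_copyWeight_right hp]

theorem sum_copyWeight_mul_snd {ζ : Type*} (hp : ∀ x, 0 ≤ p x) (z : O → ζ) (F : O → ℝ) :
    ∑ x, copyWeight p z x * F x.2 = ∑ x, p x * F x := by
  rw [← sum_copyWeight_mul_fst hp z F, ← Equiv.sum_comp (Equiv.prodComm O O)]
  refine Finset.sum_congr rfl fun x _ => ?_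
  rw [Equiv.prodComm_apply, copyWeight_swap, Prod.snd_swap]

theorem weightEntropy_copy_fst {β ζ : Type*} (hp : ∀ x, 0 ≤ p x) (z : O → ζ) (f : O → β) :
    weightEntropy (copyWeight p z) (fun x => f x.1) = weightEntropy p f := by
  classical
  have h : ∀ x : O × O, fiberMass (copyWeight p z) (fun x => f x.1) x = fiberMass p f x.1 := by
    intro x
    have := sum_copyWeight_mul_fst hp z (fun y => if f y = f x.1 then 1 else 0)
    simpa [fiberMass] using this
  unfold weightEntropy
  simp only [h]
  rw [sum_copyWeight_mul_fst hp z (fun y => Real.log (fiberMass p f y))]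

theorem weightEntropy_copy_snd {β ζ : Type*} (hp : ∀ x, 0 ≤ p x) (z : O → ζ) (f : O → β) :
    weightEntropy (copyWeight p z) (fun x => f x.2) = weightEntropy p f := by
  classical
  have h : ∀ x : O × O, fiberMass (copyWeight p z) (fun x => f x.2) x = fiberMass p f x.2 := by
    intro x
    have := sum_copyWeight_mul_snd hp z (fun y => if f y = f x.2 then 1 else 0)
    simpa [fiberMass] using this
  unfold weightEntropy
  simp only [h]
  rw [sum_copyWeight_mul_snd hp z (fun y => Real.log (fiberMass p f y))]

theorem fiberMass_copy {β γ ζ : Type*} {z : O → ζ} {f : O → β} {g : O → γ}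
    (hf : ∀ x y, f x = f y → z x = z y) (hg : ∀ x y, g x = g y → z x = z y) {x : O × O}
    (hx : z x.1 = z x.2) :
    fiberMass (copyWeight p z) (fun x => (f x.1, g x.2)) x =
      fiberMass p f x.1 * fiberMass p g x.2 / fiberMass p z x.1 := by
  classical
  unfold fiberMass
  rw [Finset.sum_mul_sum, Finset.sum_div, Fintype.sum_prod_type]
  refine Finset.sum_congr rfl fun y _ => ?_
  rw [Finset.sum_div]
  refine Finset.sum_congr rfl fun w _ => ?_
  change _ = _ / fiberMass p z x.1
  by_cases h1 : f y = f x.1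
  · by_cases h2 : g w = g x.2
    · have hy : z y = z x.1 := hf _ _ h1
      have hw : z y = z w := (hy.trans hx).trans (hg _ _ h2).symm
      simp [h1, h2, copyWeight, hw.symm, fiberMass_congr z hy]
    · simp [h2]
  · simp [h1]

/-- Conditional independence of the two coordinates of the copy: for `f` and `g` that determine
`z`, the entropy of `(f, g)` is `H(f) + H(g) - H(z)`. -/
theorem weightEntropy_copy_pair {β γ ζ : Type*} (hp : ∀ x, 0 ≤ p x) {z : O → ζ} {f : O → β}
    {g : O → γ} (hf : ∀ x y, f x = f y → z x = z y) (hg : ∀ x y, g x = g y → z x = z y) :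
    weightEntropy (copyWeight p z) (fun x => (f x.1, g x.2)) =
      weightEntropy p f + weightEntropy p g - weightEntropy p z := by
  have h : ∀ x, copyWeight p z x *
      Real.log (fiberMass (copyWeight p z) (fun x => (f x.1, g x.2)) x) =
      copyWeight p z x * Real.log (fiberMass p f x.1) +
        copyWeight p z x * Real.log (fiberMass p g x.2) -
        copyWeight p z x * Real.log (fiberMass p z x.1) := by
    intro x
    by_cases hx : copyWeight p z x = 0
    · simp [hx]
    · obtain ⟨hz, h1, h2⟩ := copyWeight_ne_zero hx
      have hf' := fiberMass_pos hp f h1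
      have hg' := fiberMass_pos hp g h2
      have hz' := fiberMass_pos hp z h1
      rw [fiberMass_copy hf hg hz, Real.log_div (mul_pos hf' hg').ne' hz'.ne',
        Real.log_mul hf'.ne' hg'.ne']
      ring
  unfold weightEntropy
  rw [Finset.sum_congr rfl fun x _ => h x, Finset.sum_sub_distrib, Finset.sum_add_distrib,
    sum_copyWeight_mul_fst hp z fun x => Real.log (fiberMass p f x),
    sum_copyWeight_mul_snd hp z fun x => Real.log (fiberMass p g x),
    sum_copyWeight_mul_fst hp z fun x => Real.log (fiberMass p z x)]
  ring

/-- Under `copyWeight p z`, the value of `z` may be read off from either coordinate. -/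
theorem weightEntropy_copy_congr {β ζ : Type*} {z : O → ζ} {f g : O × O → β}
    (h : ∀ x, z x.1 = z x.2 → f x = g x) :
    weightEntropy (copyWeight p z) f = weightEntropy (copyWeight p z) g :=
  weightEntropy_congr fun x y hx hy => by
    rw [h x (copyWeight_ne_zero hx).1, h y (copyWeight_ne_zero hy).1]

end Copy

/-! ### The Zhang–Yeung inequality -/

section ZhangYeung

variable {O : Type*} [Fintype O] {p : O → ℝ}

/-- The Zhang–Yeung inequality, given a variable `W` that has the same law as `P` jointly with
`(B, C)` and is independent of `(P, Q)` given `(B, C)`; only Shannon inequalities are used. -/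
theorem zhang_yeung_of_condIndep {β γ δ ε ζ : Type*} (hp : ∀ x, 0 ≤ p x) (P : O → β) (Q : O → γ)
    (B : O → δ) (C : O → ε) (W : O → ζ)
    (hind : weightEntropy p (fun x => (W x, P x, Q x, B x, C x)) +
        weightEntropy p (fun x => (B x, C x)) =
      weightEntropy p (fun x => (W x, B x, C x)) +
        weightEntropy p (fun x => (P x, Q x, B x, C x)))
    (hP : weightEntropy p (fun x => (W x, B x, C x)) =
      weightEntropy p (fun x => (P x, B x, C x)))
    (hPB : weightEntropy p (fun x => (W x, B x)) = weightEntropy p (fun x => (P x, B x)))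
    (hPC : weightEntropy p (fun x => (W x, C x)) = weightEntropy p (fun x => (P x, C x)))
    (hW : weightEntropy p W = weightEntropy p P) :
    weightEntropy p P + weightEntropy p (fun x => (P x, Q x)) +
        4 * weightEntropy p (fun x => (P x, B x, C x)) +
        weightEntropy p (fun x => (Q x, B x, C x)) +
        2 * weightEntropy p B + 2 * weightEntropy p C ≤
      3 * weightEntropy p (fun x => (P x, B x)) + 3 * weightEntropy p (fun x => (P x, C x)) +
        weightEntropy p (fun x => (Q x, B x)) + weightEntropy p (fun x => (Q x, C x)) +
        3 * weightEntropy p (fun x => (B x, C x)) := by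
  -- `H(W | P) + H(W | B, C) ≤ H(W | B) + H(W | C) + I(B ; C | P)`, and the same with `Q` for `P`
  have a1 := weightEntropy_submod hp (f := fun x => (W x, B x)) (g := fun x => (P x, B x))
    (k := fun x => (W x, P x, B x)) (m := B) (by simp; tauto) (by simp) (by simp)
  have a2 := weightEntropy_submod hp (f := fun x => (W x, C x)) (g := fun x => (P x, C x))
    (k := fun x => (W x, P x, C x)) (m := C) (by simp; tauto) (by simp) (by simp)
  have a3 := weightEntropy_submod hp (f := fun x => (W x, P x, B x))
    (g := fun x => (W x, P x, C x)) (k := fun x => (W x, P x, B x, C x))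
    (m := fun x => (W x, P x)) (by simp; tauto) (by simp; tauto) (by simp; tauto)
  have a4 := weightEntropy_submod hp (f := fun x => (W x, P x, B x, C x))
    (g := fun x => (P x, Q x, B x, C x)) (k := fun x => (W x, P x, Q x, B x, C x))
    (m := fun x => (P x, B x, C x)) (by simp; tauto) (by simp) (by simp; tauto)
  have b1 := weightEntropy_submod hp (f := fun x => (W x, B x)) (g := fun x => (Q x, B x))
    (k := fun x => (W x, Q x, B x)) (m := B) (by simp; tauto) (by simp) (by simp)
  have b2 := weightEntropy_submod hp (f := fun x => (W x, C x)) (g := fun x => (Q x, C x))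
    (k := fun x => (W x, Q x, C x)) (m := C) (by simp; tauto) (by simp) (by simp)
  have b3 := weightEntropy_submod hp (f := fun x => (W x, Q x, B x))
    (g := fun x => (W x, Q x, C x)) (k := fun x => (W x, Q x, B x, C x))
    (m := fun x => (W x, Q x)) (by simp; tauto) (by simp; tauto) (by simp; tauto)
  have b4 := weightEntropy_submod hp (f := fun x => (W x, Q x, B x, C x))
    (g := fun x => (P x, Q x, B x, C x)) (k := fun x => (W x, P x, Q x, B x, C x))
    (m := fun x => (Q x, B x, C x)) (by simp; tauto) (by simp) (by simp)
  -- `H(W) + H(W | B, C) ≤ H(W | P) + H(W | Q) + I(P ; Q)`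
  have c1 := weightEntropy_submod hp (f := fun x => (W x, P x)) (g := fun x => (W x, Q x))
    (k := fun x => (W x, P x, Q x)) (m := W) (by simp; tauto) (by simp; tauto)
    (by simp; tauto)
  have c2 := weightEntropy_submod hp (f := fun x => (W x, P x, Q x))
    (g := fun x => (P x, Q x, B x, C x)) (k := fun x => (W x, P x, Q x, B x, C x))
    (m := fun x => (P x, Q x)) (by simp; tauto) (by simp) (by simp; tauto)
  linarith

/-- The Zhang–Yeung inequality
`2 I(B ; C) ≤ I(P ; Q) + I(P ; B, C) + 3 I(B ; C | P) + I(B ; C | Q)`, written in entropies. The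
auxiliary variable is the conditionally independent copy of `P` over `(B, C)`. -/
theorem zhang_yeung {β γ δ ε : Type*} (hp : ∀ x, 0 ≤ p x) (P : O → β) (Q : O → γ)
    (B : O → δ) (C : O → ε) :
    weightEntropy p P + weightEntropy p (fun x => (P x, Q x)) +
        4 * weightEntropy p (fun x => (P x, B x, C x)) +
        weightEntropy p (fun x => (Q x, B x, C x)) +
        2 * weightEntropy p B + 2 * weightEntropy p C ≤
      3 * weightEntropy p (fun x => (P x, B x)) + 3 * weightEntropy p (fun x => (P x, C x)) +
        weightEntropy p (fun x => (Q x, B x)) + weightEntropy p (fun x => (Q x, C x)) +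
        3 * weightEntropy p (fun x => (B x, C x)) := by
  have h := zhang_yeung_of_condIndep (copyWeight_nonneg hp fun x => (B x, C x))
    (fun x => P x.1) (fun x => Q x.1) (fun x => B x.1) (fun x => C x.1) (fun x => P x.2)
    ?_ ?_ ?_ ?_ ?_
  · rw [weightEntropy_copy_fst hp _ P, weightEntropy_copy_fst hp _ B,
      weightEntropy_copy_fst hp _ C, weightEntropy_copy_fst hp _ fun x => (P x, Q x),
      weightEntropy_copy_fst hp _ fun x => (P x, B x, C x),
      weightEntropy_copy_fst hp _ fun x => (Q x, B x, C x),
      weightEntropy_copy_fst hp _ fun x => (P x, B x),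
      weightEntropy_copy_fst hp _ fun x => (P x, C x),
      weightEntropy_copy_fst hp _ fun x => (Q x, B x),
      weightEntropy_copy_fst hp _ fun x => (Q x, C x),
      weightEntropy_copy_fst hp _ fun x => (B x, C x)] at h
    exact h
  · have h1 := weightEntropy_copy_pair hp (z := fun x => (B x, C x))
      (f := fun x => (P x, Q x, B x, C x)) (g := fun x => (P x, B x, C x))
      (by simp) (by simp)
    have h2 := weightEntropy_copy_fst hp (fun x => (B x, C x)) fun x => (P x, Q x, B x, C x)
    have h3 := weightEntropy_copy_fst hp (fun x => (B x, C x)) fun x => (B x, C x)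
    have h4 := weightEntropy_copy_snd hp (fun x => (B x, C x)) fun x => (P x, B x, C x)
    rw [weightEntropy_copy_congr (g := fun x => (P x.2, B x.2, C x.2)) (by simp),
      weightEntropy_congr (f := fun x : O × O => (P x.2, P x.1, Q x.1, B x.1, C x.1))
        (g := fun x : O × O => ((P x.1, Q x.1, B x.1, C x.1), P x.2, B x.2, C x.2)) ?_,
      h1, h2, h3, h4]
    · ring
    · intro x y hx hy
      have hx' := (copyWeight_ne_zero hx).1
      have hy' := (copyWeight_ne_zero hy).1
      simp only [Prod.mk.injEq] at hx' hy' ⊢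
      rw [← hx'.1, ← hx'.2, ← hy'.1, ← hy'.2]
      tauto
  · rw [weightEntropy_copy_congr (g := fun x => (P x.2, B x.2, C x.2)) (by simp),
      weightEntropy_copy_snd hp _ fun x => (P x, B x, C x),
      weightEntropy_copy_fst hp _ fun x => (P x, B x, C x)]
  · rw [weightEntropy_copy_congr (g := fun x => (P x.2, B x.2)) (by simp; tauto),
      weightEntropy_copy_snd hp _ fun x => (P x, B x),
      weightEntropy_copy_fst hp _ fun x => (P x, B x)]
  · rw [weightEntropy_copy_congr (g := fun x => (P x.2, C x.2)) (by simp),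
      weightEntropy_copy_snd hp _ fun x => (P x, C x),
      weightEntropy_copy_fst hp _ fun x => (P x, C x)]
  · rw [weightEntropy_copy_snd hp _ P, weightEntropy_copy_fst hp _ P]

end ZhangYeung

/-! ### Entropy through the joint law -/

section Law

variable {Ω : Type*} [MeasurableSpace Ω]

/-- The entropy of a function of a finite-valued random variable `Z` is computed from the law of
`Z`. -/
theorem entropy_comp_eq_weightEntropy (μ : Measure Ω) [IsFiniteMeasure μ] {O β : Type*} [Fintype O]
    [Fintype β] {Z : Ω → O} (hZ : ∀ x, MeasurableSet (Z ⁻¹' {x})) (f : O → β) :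
    entropy μ (fun ω => f (Z ω)) = weightEntropy (fun x => μ.real (Z ⁻¹' {x})) f := by
  classical
  have hmass : ∀ y, μ.real ((fun ω => f (Z ω)) ⁻¹' {y}) =
      ∑ x, if f x = y then μ.real (Z ⁻¹' {x}) else 0 := by
    intro y
    have h : (fun ω => f (Z ω)) ⁻¹' {y} = Z ⁻¹' ↑(Finset.univ.filter fun x => f x = y) := by
      ext ω; simp
    rw [h, ← sum_measureReal_preimage_singleton _ fun x _ => hZ x, Finset.sum_filter]
  unfold entropy weightEntropy
  simp only [hmass, Real.negMulLog]
  rw [← Finset.sum_neg_distrib]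
  simp only [neg_mul, Finset.sum_neg_distrib, Finset.sum_mul, neg_inj]
  rw [Finset.sum_comm]
  refine Finset.sum_congr rfl fun x _ => ?_
  rw [Finset.sum_eq_single (f x)]
  · simp [fiberMass]
  · intro y _ hy
    simp [Ne.symm hy]
  · simp

theorem entropy_nonneg (μ : Measure Ω) [IsProbabilityMeasure μ] {β : Type*} [Fintype β]
    (Y : Ω → β) : 0 ≤ entropy μ Y :=
  Finset.sum_nonneg fun _ _ => Real.negMulLog_nonneg measureReal_nonneg measureReal_le_one

end Law

/-! ### The access structure induced by the Vamos matroid -/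

namespace Vamos

instance decidablePredIndep : DecidablePred Indep := fun I => by unfold Indep; infer_instance

theorem matroid_isCircuit_iff (I : Finset (Fin 8)) :
    matroid.IsCircuit (I : Set (Fin 8)) ↔ ¬ Indep I ∧ ∀ x ∈ I, Indep (I.erase x) := by
  rw [Matroid.isCircuit_iff_dep_forall_sdiff_singleton_indep,
    ← Matroid.not_indep_iff (by simp [matroid]), matroid_indep_iff]
  refine and_congr_right fun _ => ?_
  simp only [Finset.mem_coe, ← Finset.coe_erase, matroid_indep_iff]

/-- A decidable form of membership, so that concrete sets can be checked by `decide`. -/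
theorem mem_inducedAccess_iff (d : Fin 8) (T : Finset (Fin 8)) :
    T ∈ inducedAccess matroid d ↔ d ∈ T ∨ ∃ Y ∈ T.powerset, d ∉ Y ∧
      ¬ Indep (insert d Y) ∧ ∀ x ∈ insert d Y, Indep ((insert d Y).erase x) := by
  simp only [inducedAccess, Set.mem_ofPred_eq, matroid_isCircuit_iff, Finset.mem_powerset]

theorem inducedAccess_mono {d : Fin 8} {T U : Finset (Fin 8)} (h : T ⊆ U)
    (hT : T ∈ inducedAccess matroid d) : U ∈ inducedAccess matroid d := by
  rcases hT with hd | ⟨Y, hY, hc⟩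
  · exact Or.inl (h hd)
  · exact Or.inr ⟨Y, hY.trans h, hc⟩

set_option maxRecDepth 100000 in
/-- Qualified sets used in the entropy estimates, `d` being the dealer and `e` the other element
of `A`. -/
theorem qualified_of_dealer {d e : Fin 8} (h : (d = 0 ∧ e = 1) ∨ (d = 1 ∧ e = 0)) :
    {e, 2, 3} ∈ inducedAccess matroid d ∧ {e, 4, 5} ∈ inducedAccess matroid d ∧
    {e, 2, 4, 6} ∈ inducedAccess matroid d ∧ {e, 4, 6, 7} ∈ inducedAccess matroid d ∧
    {2, 4, 5, 6} ∈ inducedAccess matroid d := by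
  simp only [mem_inducedAccess_iff]
  rcases h with ⟨rfl, rfl⟩ | ⟨rfl, rfl⟩ <;> decide

set_option maxRecDepth 100000 in
/-- Unqualified sets used in the entropy estimates, `d` being the dealer and `e` the other element
of `A`. -/
theorem unqualified_of_dealer {d e : Fin 8} (h : (d = 0 ∧ e = 1) ∨ (d = 1 ∧ e = 0)) :
    {e, 6, 7} ∉ inducedAccess matroid d ∧ {2, 3, 4, 5} ∉ inducedAccess matroid d ∧
    {2, 3, 6, 7} ∉ inducedAccess matroid d ∧ {4, 5, 6, 7} ∉ inducedAccess matroid d ∧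
    {e, 2, 4} ∉ inducedAccess matroid d ∧ {e, 4, 6} ∉ inducedAccess matroid d := by
  simp only [mem_inducedAccess_iff]
  rcases h with ⟨rfl, rfl⟩ | ⟨rfl, rfl⟩ <;> decide

/-- The combinatorial part of the bound. Here `h T` stands for the entropy of the shares of `T`, `s`
for that of the secret, and `hzy` is the Zhang–Yeung inequality for the outer variables
`(secret, e)`, `D` and the inner variables `B`, `C`, each entropy with the secret being written in
terms of `h` and `s`. The ranks in the Vamos matroid violate it by `1`; the submodularity of `h`,
with the surplus `s` that it has where the secret becomes known, bounds the deviation from these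
ranks by `8 * (m - s)`. -/
theorem nine_mul_secret_le {d e : Fin 8} (hde : (d = 0 ∧ e = 1) ∨ (d = 1 ∧ e = 0))
    {h : Finset (Fin 8) → ℝ} {s m : ℝ} (hempty : 0 ≤ h ∅) (hm : ∀ i, h {i} ≤ m)
    (hsub : ∀ T U, h (T ∪ U) + h (T ∩ U) ≤ h T + h U)
    (hsub_add : ∀ T U, T ∈ inducedAccess matroid d → U ∈ inducedAccess matroid d →
      T ∪ U ∈ inducedAccess matroid d → T ∩ U ∉ inducedAccess matroid d →
      h (T ∪ U) + h (T ∩ U) + s ≤ h T + h U)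
    (hmono_add : ∀ T U, T ⊆ U → T ∉ inducedAccess matroid d → U ∈ inducedAccess matroid d →
      h T + s ≤ h U)
    (hzy : (h {e} + s) + (h ({e} ∪ D) + s) + 4 * h ({e} ∪ (B ∪ C)) + h (D ∪ (B ∪ C)) +
        2 * h B + 2 * h C ≤
      3 * h ({e} ∪ B) + 3 * h ({e} ∪ C) + h (D ∪ B) + h (D ∪ C) + 3 * h (B ∪ C)) :
    9 * s ≤ 8 * m := by
  obtain ⟨q1, q2, q3, q4, q5⟩ := qualified_of_dealer hde
  obtain ⟨u1, u2, u3, u4, u5, u6⟩ := unqualified_of_dealer hde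
  have sub : ∀ T U V W, T ∪ U = V → T ∩ U = W → h V + h W ≤ h T + h U := by
    rintro T U _ _ rfl rfl
    exact hsub T U
  have sub_add : ∀ T U V W, T ∪ U = V → T ∩ U = W → T ∈ inducedAccess matroid d →
      U ∈ inducedAccess matroid d → W ∉ inducedAccess matroid d → h V + h W + s ≤ h T + h U := by
    rintro T U _ _ rfl rfl hT hU hW
    exact hsub_add T U hT hU (inducedAccess_mono Finset.subset_union_left hT) hW
  have add : ∀ i T U, insert i T = U → i ∉ T → h U ≤ m + h T := by
    intro i T U hU hi
    have h1 := sub {i} T U ∅ hU (Finset.singleton_inter_of_notMem hi)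
    linarith [hm i]
  have he : e = 0 ∨ e = 1 := by tauto
  have eB : ({e} ∪ B : Finset (Fin 8)) = {e, 2, 3} := (Finset.insert_eq e B).symm
  have eC : ({e} ∪ C : Finset (Fin 8)) = {e, 4, 5} := (Finset.insert_eq e C).symm
  have eD : ({e} ∪ D : Finset (Fin 8)) = {e, 6, 7} := (Finset.insert_eq e D).symm
  have eBC : ({e} ∪ (B ∪ C) : Finset (Fin 8)) = {e, 2, 3, 4, 5} := by
    rcases he with rfl | rfl <;> decide
  have dbc : (D ∪ (B ∪ C) : Finset (Fin 8)) = {2, 3, 4, 5, 6, 7} := by decide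
  have db : (D ∪ B : Finset (Fin 8)) = {2, 3, 6, 7} := by decide
  have dc : (D ∪ C : Finset (Fin 8)) = {4, 5, 6, 7} := by decide
  have bc : (B ∪ C : Finset (Fin 8)) = {2, 3, 4, 5} := by decide
  rw [eBC, dbc, eB, eC, eD, db, dc, bc, B, C] at hzy
  -- reduce `hzy` to
  -- `s ≤ h(eB) + h(eC) + h(DB) + h(DC) - h(e) - h(eD) - h(eBC) - h(DBC) + 4 (m - s)`,
  -- using `a1` three times, `a2` and `a3` twice each
  have a1 := hmono_add {2, 3, 4, 5} {e, 2, 3, 4, 5} (Finset.subset_insert _ _) u2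
    (inducedAccess_mono (by rcases he with rfl | rfl <;> decide) q1)
  have a2 := add e {2, 3} {e, 2, 3} rfl (by rcases he with rfl | rfl <;> decide)
  have a3 := add e {4, 5} {e, 4, 5} rfl (by rcases he with rfl | rfl <;> decide)
  -- the right-hand side is at most `8 (m - s)`: add one element of `B`, `C` at a time, and compare
  -- the larger sets by submodularity
  have b1 := add 3 {e, 2} {e, 2, 3} (by rcases he with rfl | rfl <;> decide)
    (by rcases he with rfl | rfl <;> decide)
  have b2 := add 5 {e, 4} {e, 4, 5} (by rcases he with rfl | rfl <;> decide)
    (by rcases he with rfl | rfl <;> decide)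
  have b3 := add 2 {e} {e, 2} (by rcases he with rfl | rfl <;> decide)
    (by rcases he with rfl | rfl <;> decide)
  have b4 := add 4 {e, 6, 7} {e, 4, 6, 7} (by rcases he with rfl | rfl <;> decide)
    (by rcases he with rfl | rfl <;> decide)
  have c1 := sub {e, 2, 4} {e, 4, 6} {e, 2, 4, 6} {e, 4}
    (by rcases he with rfl | rfl <;> decide) (by rcases he with rfl | rfl <;> decide)
  have c2 := sub_add {e, 2, 4, 6} {e, 2, 3, 4, 5} {e, 2, 3, 4, 5, 6} {e, 2, 4}
    (by rcases he with rfl | rfl <;> decide) (by rcases he with rfl | rfl <;> decide) q3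
    (inducedAccess_mono (by rcases he with rfl | rfl <;> decide) q1) u5
  have c3 := sub_add {e, 4, 6, 7} {e, 2, 3, 4, 5, 6} {e, 2, 3, 4, 5, 6, 7} {e, 4, 6}
    (by rcases he with rfl | rfl <;> decide) (by rcases he with rfl | rfl <;> decide) q4
    (inducedAccess_mono (by rcases he with rfl | rfl <;> decide) q1) u6
  have d1 := hmono_add {2, 3, 6, 7} {e, 2, 3, 4, 5, 6, 7}
    (by rcases he with rfl | rfl <;> decide) u3
    (inducedAccess_mono (by rcases he with rfl | rfl <;> decide) q1)
  have d2 := hmono_add {4, 5, 6, 7} {2, 3, 4, 5, 6, 7} (by decide) u4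
    (inducedAccess_mono (by decide) q5)
  linarith

end Vamos

/-! ### Entropies of sets of shares -/

section Scheme

variable {O ι σ : Type*} [Fintype O] [DecidableEq ι] {α : ι → Type*} {p : O → ℝ}

/-- Submodularity of the joint entropy of `s` and the shares of a set of participants. A constant
`s` gives the submodularity of the entropy of the shares. -/
theorem weightEntropy_shares_submod (hp : ∀ x, 0 ≤ p x) (s : O → σ) (X : ∀ i, O → α i)
    (T U : Finset ι) :
    weightEntropy p (fun x => (s x, fun i : (T ∪ U : Finset ι) => X i x)) +
        weightEntropy p (fun x => (s x, fun i : (T ∩ U : Finset ι) => X i x)) ≤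
      weightEntropy p (fun x => (s x, fun i : T => X i x)) +
        weightEntropy p (fun x => (s x, fun i : U => X i x)) := by
  refine weightEntropy_submod hp ?_ ?_ ?_ <;> intro x y <;>
    simp only [Prod.mk.injEq, funext_iff, Subtype.forall, Finset.mem_union, Finset.mem_inter]
  · exact ⟨fun h => ⟨⟨h.1, fun i hi => h.2 i (.inl hi)⟩, h.1, fun i hi => h.2 i (.inr hi)⟩,
      fun h => ⟨h.1.1, fun i hi => hi.elim (h.1.2 i) (h.2.2 i)⟩⟩
  · exact fun h => ⟨h.1, fun i hi => h.2 i hi.1⟩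
  · exact fun h => ⟨h.1, fun i hi => h.2 i hi.2⟩

/-- The Zhang–Yeung inequality for sets of shares, with the variable `s` adjoined to `P`. -/
theorem zhang_yeung_shares (hp : ∀ x, 0 ≤ p x) (s : O → σ) (X : ∀ i, O → α i)
    (P Q B C : Finset ι) :
    weightEntropy p (fun x => (s x, fun i : P => X i x)) +
        weightEntropy p (fun x => (s x, fun i : (P ∪ Q : Finset ι) => X i x)) +
        4 * weightEntropy p (fun x => (s x, fun i : (P ∪ (B ∪ C) : Finset ι) => X i x)) +
        weightEntropy p (fun x => fun i : (Q ∪ (B ∪ C) : Finset ι) => X i x) +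
        2 * weightEntropy p (fun x => fun i : B => X i x) +
        2 * weightEntropy p (fun x => fun i : C => X i x) ≤
      3 * weightEntropy p (fun x => (s x, fun i : (P ∪ B : Finset ι) => X i x)) +
        3 * weightEntropy p (fun x => (s x, fun i : (P ∪ C : Finset ι) => X i x)) +
        weightEntropy p (fun x => fun i : (Q ∪ B : Finset ι) => X i x) +
        weightEntropy p (fun x => fun i : (Q ∪ C : Finset ι) => X i x) +
        3 * weightEntropy p (fun x => fun i : (B ∪ C : Finset ι) => X i x) := by
  have secret_pair : ∀ T U : Finset ι,
      weightEntropy p (fun x => ((s x, fun i : T => X i x), fun i : U => X i x)) =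
        weightEntropy p (fun x => (s x, fun i : (T ∪ U : Finset ι) => X i x)) := fun T U =>
    weightEntropy_congr fun x y _ _ => by
      simp only [Prod.mk.injEq, funext_iff, Subtype.forall, Finset.mem_union, or_imp, forall_and,
        and_assoc]
  have share_pair : ∀ T U : Finset ι,
      weightEntropy p (fun x => ((fun i : T => X i x), fun i : U => X i x)) =
        weightEntropy p (fun x => fun i : (T ∪ U : Finset ι) => X i x) := fun T U =>
    weightEntropy_congr fun x y _ _ => by
      simp only [Prod.mk.injEq, funext_iff, Subtype.forall, Finset.mem_union, or_imp, forall_and]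
  have secret_triple : weightEntropy p (fun x => ((s x, fun i : P => X i x),
        (fun i : B => X i x), fun i : C => X i x)) =
        weightEntropy p (fun x => (s x, fun i : (P ∪ (B ∪ C) : Finset ι) => X i x)) :=
    weightEntropy_congr fun x y _ _ => by
      simp only [Prod.mk.injEq, funext_iff, Subtype.forall, Finset.mem_union, or_imp, forall_and,
        and_assoc]
  have share_triple : weightEntropy p (fun x => ((fun i : Q => X i x),
        (fun i : B => X i x), fun i : C => X i x)) =
        weightEntropy p (fun x => fun i : (Q ∪ (B ∪ C) : Finset ι) => X i x) :=
    weightEntropy_congr fun x y _ _ => by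
      simp only [Prod.mk.injEq, funext_iff, Subtype.forall, Finset.mem_union, or_imp, forall_and]
  have h := zhang_yeung hp (fun x => (s x, fun i : P => X i x)) (fun x (i : Q) => X i x)
    (fun x (i : B) => X i x) (fun x (i : C) => X i x)
  rw [secret_pair, secret_pair, secret_pair, share_pair, share_pair, share_pair, secret_triple,
    share_triple] at h
  exact h

end Scheme

theorem theoremA {Ω : Type*} [MeasurableSpace Ω] (μ : Measure Ω) [IsProbabilityMeasure μ]
    {σ : Type*} [Fintype σ] [MeasurableSpace σ] [MeasurableSingletonClass σ]
    {α : Fin 8 → Type*} [∀ i, Fintype (α i)] [∀ i, MeasurableSpace (α i)]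
    [∀ i, MeasurableSingletonClass (α i)]
    (S : Ω → σ) (hS : Measurable S) (X : ∀ i, Ω → α i) (hX : ∀ i, Measurable (X i))
    (hpos : 0 < entropy μ S) (d : Fin 8) (hd : d ∈ Vamos.A)
    (hscheme : IsPerfectScheme (inducedAccess Vamos.matroid d) μ S X) :
    2 / 19 ≤ lambdaExcess μ S X := by
  obtain ⟨e, hde⟩ : ∃ e : Fin 8, (d = 0 ∧ e = 1) ∨ (d = 1 ∧ e = 0) := by
    simp only [Vamos.A, Finset.mem_insert, Finset.mem_singleton] at hd
    rcases hd with rfl | rfl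
    · exact ⟨1, by simp⟩
    · exact ⟨0, by simp⟩
  -- all entropies are computed from the joint law `p` of the secret and the shares
  have hZ : ∀ x : σ × (∀ i, α i), MeasurableSet ((fun ω => (S ω, fun i => X i ω)) ⁻¹' {x}) :=
    fun x => (hS.prodMk (measurable_pi_lambda _ hX)) (measurableSet_singleton x)
  let p : σ × (∀ i, α i) → ℝ := fun x => μ.real ((fun ω => (S ω, fun i => X i ω)) ⁻¹' {x})
  have hp : ∀ x, 0 ≤ p x := fun x => measureReal_nonneg
  have hshare : ∀ T : Finset (Fin 8), entropy μ (jointShare X T) =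
      weightEntropy p (fun x => fun i : T => x.2 i) := fun T =>
    entropy_comp_eq_weightEntropy μ hZ fun x (i : T) => x.2 i
  have hsecret : ∀ T : Finset (Fin 8), entropy μ (fun ω => (S ω, jointShare X T ω)) =
      weightEntropy p (fun x => (x.1, fun i : T => x.2 i)) := fun T =>
    entropy_comp_eq_weightEntropy μ hZ fun x => (x.1, fun i : T => x.2 i)
  have hqual : ∀ T ∈ inducedAccess Vamos.matroid d,
      weightEntropy p (fun x => (x.1, fun i : T => x.2 i)) = entropy μ (jointShare X T) :=
    fun T hT => by
      have h := hscheme.qualified T hT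
      rw [condEntropy, hsecret] at h
      linarith
  have hunqual : ∀ T ∉ inducedAccess Vamos.matroid d,
      weightEntropy p (fun x => (x.1, fun i : T => x.2 i)) =
        entropy μ (jointShare X T) + entropy μ S :=
    fun T hT => by
      have h := hscheme.unqualified T hT
      rw [condEntropy, hsecret] at h
      linarith
  have hmain := Vamos.nine_mul_secret_le hde (h := fun T => entropy μ (jointShare X T))
    (s := entropy μ S) (m := (lambdaExcess μ S X + 1) * entropy μ S) ?_ ?_ ?_ ?_ ?_ ?_
  -- dividing `9 * H(S) ≤ 8 * (λ + 1) * H(S)` by `H(S) > 0` gives `λ ≥ 1/8`, and `1/8 > 2/19`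
  · have h : 9 ≤ 8 * (lambdaExcess μ S X + 1) :=
      le_of_mul_le_mul_right (by linarith) hpos
    linarith
  · exact entropy_nonneg μ _
  · intro i
    rw [← div_le_iff₀ hpos, lambdaExcess, sub_add_cancel]
    exact Finset.le_sup' (fun i => normEntropy μ S X {i}) (Finset.mem_univ i)
  · intro T U
    have hc : ∀ T : Finset (Fin 8), entropy μ (jointShare X T) =
      weightEntropy p (fun x => ((), fun i : T => x.2 i)) := fun T =>
      (hshare T).trans (weightEntropy_congr fun x y _ _ => by simp)
    simp only [hc]
    exact weightEntropy_shares_submod hp (fun _ => ()) (fun i x => x.2 i) T U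
  · intro T U hT hU hTU hI
    have h := weightEntropy_shares_submod hp (fun x => x.1) (fun i x => x.2 i) T U
    rw [hqual T hT, hqual U hU, hqual _ hTU, hunqual _ hI] at h
    linarith
  · intro T U hTU hT hU
    have h := weightEntropy_mono hp (f := fun x => (x.1, fun i : U => x.2 i))
      (g := fun x => (x.1, fun i : T => x.2 i)) fun x y hxy => by
        simp only [Prod.mk.injEq, funext_iff, Subtype.forall] at hxy ⊢
        exact ⟨hxy.1, fun i hi => hxy.2 i (hTU hi)⟩
    rwa [hunqual T hT, hqual U hU] at h
  -- the Zhang–Yeung inequality for the outer variables `(S, X_e)`, `X_D`; perfectness expresses it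
  -- in the entropies of the shares and of the secret
  · have h := zhang_yeung_shares hp (fun x => x.1) (fun i x => x.2 i) {e} Vamos.D Vamos.B Vamos.C
    obtain ⟨q1, q2, -⟩ := Vamos.qualified_of_dealer hde
    obtain ⟨u1, -⟩ := Vamos.unqualified_of_dealer hde
    have hB : {e} ∪ Vamos.B ∈ inducedAccess Vamos.matroid d := by
      rw [← Finset.insert_eq]
      exact q1
    have hC : {e} ∪ Vamos.C ∈ inducedAccess Vamos.matroid d := by
      rw [← Finset.insert_eq]
      exact q2
    have hBC : {e} ∪ (Vamos.B ∪ Vamos.C) ∈ inducedAccess Vamos.matroid d :=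
      Vamos.inducedAccess_mono (Finset.union_subset_union_right Finset.subset_union_left) hB
    have hD : {e} ∪ Vamos.D ∉ inducedAccess Vamos.matroid d := by
      rw [← Finset.insert_eq]
      exact u1
    have he : {e} ∉ inducedAccess Vamos.matroid d := fun hq =>
      hD (Vamos.inducedAccess_mono Finset.subset_union_left hq)
    rw [hunqual _ he, hunqual _ hD, hqual _ hBC, hqual _ hB, hqual _ hC] at h
    simpa only [hshare] using h
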